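/- **Dyadic matrices.** Let $N,k\ge 1$ and $d=k(2^N-1)$. For $1\le l\le N$ and $1\le r\le 2^{N-l}$ let $I_{r,l}=\{2^{l-1}(2r-1)\}$, let $I'_{r,1}=I_{r,1}$ and $I'_{r,l}=I_{r,l}\cup I'_{2r-1,l-1}\cup I'_{2r,l-1}$ for $l\ge2$, and let $I_l=\bigcup_r I_{r,l}$ (level $l$). Partition $d\times d$ real matrices into $(2^N-1)\times(2^N-1)$ blocks of size $k\times k$. Such a matrix belongs to $\mathcal{VD}(N)$ (vertically dyadic) if its $(i,j)$ block vanishes whenever $(i,j)\notin\bigcup_{l,r}I'_{r,l}\times I_{r,l}$, and to $\mathcal{SD}(N)$ (symmetrically dyadic) if its $(i,j)$ block vanishes whenever $(i,j)\notin\bigcup_{l,r}\big((I_{r,l}\times I'_{r,l})\cup(I'_{r,l}\times I_{r,l})\big)$. **Algorithm (sequential dyadic orthogonalization).** The input is a positive definite $\boldsymbol\Sigma\in\mathcal{SD}(N)$, given by its blocks in the $\mathcal{SD}(N)$ positions. Let $\boldsymbol\Sigma_{l',l}$ be its submatrix with block rows in $I_{l'}$ and block columns in $I_l$. Start with $\mathbf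 P=\mathbf G(\boldsymbol\Sigma_{1,1})$. For $l=2,\dots,N$ compute $$\check{\boldsymbol\Sigma}=\begin{bmatrix}\boldsymbol\Sigma_{1,l}\\ \vdots\\ \boldsymbol\Sigma_{l-1,l}\end{bmatrix},\quad \check{\boldsymbol\Sigma}'=\mathbf P^\top\check{\boldsymbol\Sigma},\quad \mathbf A=\mathbf P\check{\boldsymbol\Sigma}',\quad \tilde{\boldsymbol\Sigma}=\boldsymbol\Sigma_{l,l}-\check{\boldsymbol\Sigma}'^\top\check{\boldsymbol\Sigma}',\quad \mathbf G=\mathbf G(\tilde{\boldsymbol\Sigma}),$$ and replace $\mathbf P$ by $\begin{bmatrix}\mathbf P&-\mathbf A\mathbf G\\ \mathbf 0&\mathbf G\end{bmatrix}$. Return $\mathbf P$, with block rows and columns put back into the order $1,\dots,2^N-1$. Here $\mathbf G(\cdot)$ applies to each diagonal $k\times k$ block $\mathbf T$ the Gram–Schmidt method for the inner product $\langle x,y\rangle=x^\top\mathbf T y$ and the standard basis of $\mathbb R^k$, the columns of the result being the orthonormalized vectors. Products and differences are computed block by block with the schoolbook formulas; blocks that are structurally zero (because they are zero by the $\mathcal{SD}(N)$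 pattern or arise only from such blocks) are not stored and no operations are performed on them. Arithmetic is exact, and each addition, subtraction, multiplication, division, negation and square root of real scalars counts as one flop. **Theorem.** There is an absolute constant $C>0$ such that for all $N,k\ge1$ and every positive definite $\boldsymbol\Sigma\in\mathcal{SD}(N)$ the algorithm returns a matrix $\mathbf P\in\mathcal{VD}(N)$ with $\mathbf P^\top\boldsymbol\Sigma\mathbf P=\mathbf I$, and, if $N\ge2$, it performs at most $$C\,d\,k^2\log^2(d/k)$$ flops. -/

import Mathlib

/-! ## Dyadic block-sparsity patterns

Block indices are the integers `1, …, 2 ^ N - 1`. -/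

/-- The pyramid `I_{r,l} = {2^(l-1) (2r-1)}`. -/
def pyr (r l : ℕ) : Finset ℕ := {2 ^ (l - 1) * (2 * r - 1)}

/-- The pyramid `I'_{r,l}`, with `I'_{r,1} = I_{r,1}` and
`I'_{r,l} = I_{r,l} ∪ I'_{2r-1,l-1} ∪ I'_{2r,l-1}` for `l ≥ 2` (level `0` is empty). -/
def pyr' (r : ℕ) : ℕ → Finset ℕ
  | 0 => ∅
  | l + 1 => pyr r (l + 1) ∪ pyr' (2 * r - 1) l ∪ pyr' (2 * r) l

/-- The `l`th level `I_l = ⋃_{r=1}^{2^(N-l)} I_{r,l}` of the pyramid of height `N`. -/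
def pyrLevel (N l : ℕ) : Finset ℕ := (Finset.Icc 1 (2 ^ (N - l))).biUnion fun r => pyr r l

/-- The union `I_1 ∪ … ∪ I_{l-1}` of the levels below the `l`th one. -/
def pyrBelow (N l : ℕ) : Finset ℕ := (Finset.Icc 1 (l - 1)).biUnion (pyrLevel N)

/-- The horizontally dyadic pattern `⋃_{l,r} I_{r,l} × I'_{r,l}` of height `N`. -/
def HDPattern (N : ℕ) : Finset (ℕ × ℕ) :=
  (Finset.Icc 1 N).biUnion fun l =>
    (Finset.Icc 1 (2 ^ (N - l))).biUnion fun r => pyr r l ×ˢ pyr' r l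

/-- The vertically dyadic pattern of height `N`: the transpose of the horizontal one. -/
def VDPattern (N : ℕ) : Finset (ℕ × ℕ) := (HDPattern N).image Prod.swap

/-- The symmetrically dyadic pattern of height `N`. -/
def SDPattern (N : ℕ) : Finset (ℕ × ℕ) := HDPattern N ∪ VDPattern N

/-- An `nk × nk` matrix, partitioned into an `n × n` array of `k × k` blocks (the entry in row `p`,
column `q` of the block in position `(i + 1, j + 1)` is `A (i, p) (j, q)`), has the block-sparsity
pattern `I` if all its blocks in positions outside `I` vanish. -/
def HasBlockPattern {n k : ℕ} (I : Finset (ℕ × ℕ))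
    (A : Matrix (Fin n × Fin k) (Fin n × Fin k) ℝ) : Prop :=
  ∀ i j : Fin n, ((i : ℕ) + 1, (j : ℕ) + 1) ∉ I → ∀ p q : Fin k, A (i, p) (j, q) = 0

/-! ## Programs and their flops -/

/-- The floating-point operations on scalars from `V`. -/
inductive FlopOp (V : Type) : Type
  | add (x y : V)
  | sub (x y : V)
  | mul (x y : V)
  | div (x y : V)
  | neg (x : V)
  | sqrt (x : V)

/-- The exact result of a floating-point operation. -/
noncomputable def FlopOp.eval : FlopOp ℝ → ℝ
  | .add x y => x + y
  | .sub x y => x - y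
  | .mul x y => x * y
  | .div x y => x / y
  | .neg x => -x
  | .sqrt x => Real.sqrt x

/-- A program either returns a result, or performs one floating-point operation and continues with
its outcome. Algorithms are written below for an arbitrary type `V` of scalars about which nothing
is known except two constants `0` and `1`, so that new scalars can arise only through `flop`. -/
inductive Prog (V α : Type) : Type
  | ret (a : α) : Prog V α
  | flop (o : FlopOp V) (next : V → Prog V α) : Prog V α

namespace Prog

/-- Sequential composition of programs. -/
def bind {V α β : Type} : Prog V α → (α → Prog V β) → Prog V β
  | ret a, f => f a
  | flop o next, f => flop o fun v => (next v).bind f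

instance {V : Type} : Monad (Prog V) where
  pure := ret
  bind := bind

/-- The result of running a program over the reals. -/
noncomputable def val {α : Type} : Prog ℝ α → α
  | ret a => a
  | flop o next => (next o.eval).val

/-- The number of floating-point operations performed by running a program over the reals. -/
noncomputable def flops {α : Type} : Prog ℝ α → ℕ
  | ret _ => 0
  | flop o next => (next o.eval).flops + 1

/-- Perform a single floating-point operation. -/
def op {V : Type} (o : FlopOp V) : Prog V V := flop o ret

/-- Run `f 0, …, f (n - 1)` one after the other and collect the results in an array. -/
def tab {V α : Type} : {n : ℕ} → (Fin n → Prog V α) → Prog V (Fin n → α)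
  | 0, _ => pure Fin.elim0
  | _ + 1, f => do
    let a ← f 0
    let as ← tab fun i => f i.succ
    pure (Fin.cons a as)

/-- The loop `for i = 0, …, n - 1` that updates a state `s` to the outcome of `f s i`. -/
def loop {V σ : Type} : {n : ℕ} → (σ → Fin n → Prog V σ) → σ → Prog V σ
  | 0, _, s => pure s
  | _ + 1, f, s => do
    let s' ← f s 0
    loop (fun t i => f t i.succ) s'

end Prog

/-! ## Dense `k × k` blocks -/

/-- A dense `k × k` block of scalars. -/
abbrev Block (V : Type) (k : ℕ) : Type := Fin k → Fin k → V

namespace Block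

variable {V : Type} {k : ℕ}

/-- The scalar product `∑ m, x m * y m` of two vectors. -/
def dot [Zero V] (x y : Fin k → V) : Prog V V :=
  Prog.loop (fun s m => do
    let t ← Prog.op (.mul (x m) (y m))
    Prog.op (.add s t)) 0

/-- The product of two blocks. -/
def mul [Zero V] (a b : Block V k) : Prog V (Block V k) :=
  Prog.tab fun p => Prog.tab fun q => dot (fun m => a p m) (fun m => b m q)

/-- The sum of two blocks. -/
def add (a b : Block V k) : Prog V (Block V k) :=
  Prog.tab fun p => Prog.tab fun q => Prog.op (.add (a p q) (b p q))

/-- The difference of two blocks. -/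
def sub (a b : Block V k) : Prog V (Block V k) :=
  Prog.tab fun p => Prog.tab fun q => Prog.op (.sub (a p q) (b p q))

/-- The negative of a block. -/
def neg (a : Block V k) : Prog V (Block V k) :=
  Prog.tab fun p => Prog.tab fun q => Prog.op (.neg (a p q))

/-- One step of the Gram-Schmidt method for the inner product `⟨x, y⟩ = xᵀ T y`. The columns of `g`
before the `j`th one hold the vectors `g_i` found so far, the other columns are zero. The `j`th
column becomes `v / ‖v‖`, where `v = e_j - ∑ i, ⟨g_i, e_j⟩ g_i`. -/
def gramSchmidtStep [Zero V] [One V] (T g : Block V k) (j : Fin k) : Prog V (Block V k) := do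
  let c ← Prog.tab fun i => dot (fun m => g m i) (fun m => T m j)
  let u ← Prog.tab fun m => dot (fun i => g m i) c
  let v ← Prog.tab fun m => Prog.op (.sub (if m = j then 1 else 0) (u m))
  let w ← Prog.tab fun m => dot (fun q => T m q) v
  let n ← dot v w
  let s ← Prog.op (.sqrt n)
  let h ← Prog.tab fun m => Prog.op (.div (v m) s)
  pure fun m q => if q = j then h m else g m q

/-- The Gram-Schmidt method applied to a Gramian `T = Fᵀ F`: it returns the matrix `G` for which
the columns of `F G` are the Gram-Schmidt orthonormalization of the columns of `F`. -/
def gramSchmidt [Zero V] [One V] (T : Block V k) : Prog V (Block V k) :=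
  Prog.loop (gramSchmidtStep T) fun _ _ => 0

end Block

/-! ## Block-sparse matrices -/

/-- A block-sparse matrix, stored as an `n × n` array of `k × k` blocks, where `none` stands for a
zero block that is not stored and on which no operations are performed. -/
abbrev SparseMat (V : Type) (n k : ℕ) : Type := Fin n → Fin n → Option (Block V k)

namespace SparseMat

variable {V : Type} {n k : ℕ}

/-- The matrix represented by an array of blocks. -/
def toMatrix (A : SparseMat ℝ n k) : Matrix (Fin n × Fin k) (Fin n × Fin k) ℝ :=
  fun x y => match A x.1 y.1 with
    | none => 0
    | some a => a x.2 y.2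

/-- The array that stores the blocks of a matrix in the positions of the pattern `I`. -/
def ofMatrix (I : Finset (ℕ × ℕ)) (A : Matrix (Fin n × Fin k) (Fin n × Fin k) ℝ) :
    SparseMat ℝ n k :=
  fun i j => if ((i : ℕ) + 1, (j : ℕ) + 1) ∈ I then some fun p q => A (i, p) (j, q) else none

/-- The submatrix with block rows in `R` and block columns in `S` (in its place in the full
matrix). -/
def restrict (R S : Finset ℕ) (A : SparseMat V n k) : SparseMat V n k :=
  fun i j => if (i : ℕ) + 1 ∈ R ∧ (j : ℕ) + 1 ∈ S then A i j else none

/-- The transpose. -/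
def transpose (A : SparseMat V n k) : SparseMat V n k :=
  fun i j => (A j i).map fun a p q => a q p

/-- The product: in position `(i, j)`, the sum of the products of the `(i, m)` and `(m, j)` blocks
over those `m` for which both are stored. -/
def mul [Zero V] (A B : SparseMat V n k) : Prog V (SparseMat V n k) :=
  Prog.tab fun i => Prog.tab fun j =>
    Prog.loop (fun (s : Option (Block V k)) m =>
      match A i m, B m j with
      | some a, some b => do
        let c ← Block.mul a b
        match s with
        | none => pure (some c)
        | some t => do
          let r ← Block.add t c
          pure (some r)
      | _, _ => pure s) none

/-- The difference. -/
def sub (A B : SparseMat V n k) : Prog V (SparseMat V n k) :=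
  Prog.tab fun i => Prog.tab fun j =>
    match A i j, B i j with
    | some a, some b => do
      let c ← Block.sub a b
      pure (some c)
    | none, some b => do
      let c ← Block.neg b
      pure (some c)
    | s, none => pure s

/-- The negative. -/
def neg (A : SparseMat V n k) : Prog V (SparseMat V n k) :=
  Prog.tab fun i => Prog.tab fun j =>
    match A i j with
    | some a => do
      let c ← Block.neg a
      pure (some c)
    | none => pure none

/-- The orthonormalization `G_l` of block-diagonal Gramians: the Gram-Schmidt method is applied to
each of the diagonal blocks. -/
def orth [Zero V] [One V] (A : SparseMat V n k) : Prog V (SparseMat V n k) :=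
  Prog.tab fun i => Prog.tab fun j =>
    match A i i with
    | some a =>
      if i = j then do
        let c ← Block.gramSchmidt a
        pure (some c)
      else pure none
    | none => pure none

end SparseMat

/-! ## The sequential (dyadic) orthogonalization algorithm -/

/-- The body of the loop of the algorithm for the level `l`. Here `Σ_{l',l}` is the submatrix of
`S` with block rows in the level `I_{l'}` and block columns in the level `I_l`, and `P` is the
matrix found for the levels below `l`. -/
def dyadicStep {V : Type} [Zero V] [One V] {n k : ℕ} (N : ℕ) (S : SparseMat V n k) (l : ℕ)
    (P : SparseMat V n k) : Prog V (SparseMat V n k) := do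
  -- the column of the blocks `Σ_{1,l}, …, Σ_{l-1,l}`
  let E := S.restrict (pyrBelow N l) (pyrLevel N l)
  let E' ← P.transpose.mul E
  let A ← P.mul E'
  let Q ← E'.transpose.mul E'
  let T ← (S.restrict (pyrLevel N l) (pyrLevel N l)).sub Q
  let G ← T.orth
  let AG ← A.mul G
  let B ← AG.neg
  -- the block matrix with rows `P, -AG` and `0, G`
  pure fun i j =>
    if (j : ℕ) + 1 ∈ pyrLevel N l then
      if (i : ℕ) + 1 ∈ pyrLevel N l then G i j else B i j
    else P i j

/-- The matrix `P` after the levels `1, …, m + 1`: first the orthonormalization of `Σ_{1,1}`, then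
the loop over `l = 2, …, m + 1`. -/
def dyadicLoop {V : Type} [Zero V] [One V] {n k : ℕ} (N : ℕ) (S : SparseMat V n k) :
    ℕ → Prog V (SparseMat V n k)
  | 0 => (S.restrict (pyrLevel N 1) (pyrLevel N 1)).orth
  | m + 1 => do
    let P ← dyadicLoop N S m
    dyadicStep N S (m + 2) P

/-- The sequential orthogonalization algorithm for the pyramid of height `N`. -/
def dyadicAlgorithm {V : Type} [Zero V] [One V] {k : ℕ} (N : ℕ)
    (S : SparseMat V (2 ^ N - 1) k) : Prog V (SparseMat V (2 ^ N - 1) k) :=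
  dyadicLoop N S (N - 1)

/-!
Why the algorithm works. Let `M` be the matrix `P` after some level, regarded as a matrix of full
size, so that `Mᵀ S M = D` is the projection onto the levels treated so far, and let `L` be the
projection onto the next level. With `F = Mᵀ S L` the columns of `W = L - M F` are orthogonal to
those of `M` for the inner product given by `S` (`orthogonal_complement`), and their Gramian is the
Schur complement `L S L - Fᵀ F` (`schur_complement`), which is what the algorithm calls `T`. Its
diagonal blocks are positive definite because `W` is the identity on the rows of the new level
(`SparseMat.posDef_block`). If `T` is block diagonal, orthonormalizing its blocks by the
Gram–Schmidt method (`Block.gramSchmidt_gram`, `SparseMat.orth_gram`) gives `G` with `Gᵀ T G = L`,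
and appending the columns of `W G` extends `Mᵀ S M = D` to the new level (`gram_append`).

The sparsity is a matter of the binary tree on `1, …, 2 ^ N - 1` in which the descendants of a node
of level `l` are the other integers at distance less than `2 ^ (l - 1)` from it. A block position
`(i, j)` is in the vertically dyadic pattern if and only if `i` is `j` or a descendant of `j`
(`mem_VDPattern`). Two ancestors of a common node are comparable (`DyadicDesc.of_common`), and a
node has at most one ancestor in each level (`DyadicDesc.ancestor_unique`). Hence `F` and `M F` are
vertically dyadic, and `Fᵀ F`, so `T`, is block diagonal.

For the cost, a block product at the level `l` amounts to a node together with one of its at most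
`N` ancestors and its only ancestor in the level `l`. So each level takes `O(N (2 ^ N - 1))` block
operations of `O(k ^ 3)` flops each (`dyadicStep_spec`), there are `N` levels, and
`N = O(log (2 ^ N - 1)) = O(log (d / k))` for `N ≥ 2`.
-/

/-! ### Results and costs of programs -/

namespace Prog

@[simp] lemma val_pure {α : Type} (a : α) : (pure a : Prog ℝ α).val = a := rfl

@[simp] lemma flops_pure {α : Type} (a : α) : (pure a : Prog ℝ α).flops = 0 := rfl

@[simp] lemma val_bind {α β : Type} (p : Prog ℝ α) (f : α → Prog ℝ β) :
    (p >>= f).val = (f p.val).val := by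
  induction p with
  | ret a => rfl
  | flop o next ih => exact ih _

@[simp] lemma flops_bind {α β : Type} (p : Prog ℝ α) (f : α → Prog ℝ β) :
    (p >>= f).flops = p.flops + (f p.val).flops := by
  induction p with
  | ret a => exact (Nat.zero_add _).symm
  | flop o next ih =>
    change ((next o.eval) >>= f).flops + 1 = (next o.eval).flops + 1 + (f (next o.eval).val).flops
    rw [ih]
    omega

@[simp] lemma val_op (o : FlopOp ℝ) : (op o).val = o.eval := rfl

@[simp] lemma flops_op (o : FlopOp ℝ) : (op o).flops = 1 := rfl

@[simp] lemma val_tab {α : Type} {n : ℕ} (f : Fin n → Prog ℝ α) :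
    (tab f).val = fun i => (f i).val := by
  induction n with
  | zero => funext i; exact i.elim0
  | succ n ih =>
    funext i
    simp only [tab, val_bind, val_pure, ih]
    refine Fin.cases ?_ (fun i => ?_) i <;> simp

@[simp] lemma flops_tab {α : Type} {n : ℕ} (f : Fin n → Prog ℝ α) :
    (tab f).flops = ∑ i, (f i).flops := by
  induction n with
  | zero => simp [tab]
  | succ n ih => simp [tab, ih, Fin.sum_univ_succ]

lemma val_tab_tab {α : Type} {m n : ℕ} (f : Fin m → Fin n → Prog ℝ α) (i : Fin m) (j : Fin n) :
    (tab fun i => tab fun j => f i j).val i j = (f i j).val := by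
  simp

/-- Loop invariants: a property that holds initially and is preserved by each pass of the loop
holds at its end. -/
lemma loop_invariant {σ : Type} {n : ℕ} (f : σ → Fin n → Prog ℝ σ) (inv : ℕ → σ → Prop)
    (step : ∀ (i : Fin n) (s : σ), inv i s → inv (i + 1) (f s i).val) (s : σ) (h : inv 0 s) :
    inv n (loop f s).val := by
  induction n generalizing s inv with
  | zero => exact h
  | succ n ih =>
    simp only [loop, val_bind]
    exact ih _ (fun m => inv (m + 1)) (fun i t ht => step i.succ t ht) _ (step 0 s h)

lemma flops_loop_le {σ : Type} {n : ℕ} (f : σ → Fin n → Prog ℝ σ) (c : Fin n → ℕ)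
    (hc : ∀ s i, (f s i).flops ≤ c i) (s : σ) : (loop f s).flops ≤ ∑ i, c i := by
  induction n generalizing s with
  | zero => simp [loop]
  | succ n ih =>
    simp only [loop, flops_bind, Fin.sum_univ_succ]
    exact Nat.add_le_add (hc _ _) (ih _ _ (fun s i => hc s i.succ) _)

end Prog

/-! ### Dense blocks -/

namespace Block

variable {k : ℕ}

lemma val_dot_loop {n : ℕ} (x y : Fin n → ℝ) (s : ℝ) :
    (Prog.loop (fun s m => do
      let t ← Prog.op (.mul (x m) (y m))
      Prog.op (.add s t)) s).val = s + ∑ m, x m * y m := by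
  induction n generalizing s with
  | zero => simp [Prog.loop]
  | succ n ih =>
    simp only [Prog.loop, Prog.val_bind, Prog.val_op, FlopOp.eval] at ih ⊢
    rw [ih (fun i => x i.succ) (fun i => y i.succ), Fin.sum_univ_succ, add_assoc]

@[simp] lemma val_dot (x y : Fin k → ℝ) : (dot x y).val = ∑ m, x m * y m := by
  exact (val_dot_loop x y 0).trans (zero_add _)

lemma flops_dot_le (x y : Fin k → ℝ) : (dot x y).flops ≤ 2 * k := by
  refine (Prog.flops_loop_le _ (fun _ => 2) (fun s i => ?_) _).trans (by simp [mul_comm])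
  simp

@[simp] lemma of_val_mul (a b : Block ℝ k) :
    Matrix.of (mul a b).val = Matrix.of a * Matrix.of b := by
  ext p q
  simp [mul, Matrix.mul_apply]

lemma flops_mul_le (a b : Block ℝ k) : (mul a b).flops ≤ 2 * k ^ 3 := by
  simp only [mul, Prog.flops_tab]
  calc _ ≤ ∑ _p : Fin k, ∑ _q : Fin k, 2 * k :=
        Finset.sum_le_sum fun p _ => Finset.sum_le_sum fun q _ => flops_dot_le _ _
    _ = 2 * k ^ 3 := by simp; ring

@[simp] lemma of_val_add (a b : Block ℝ k) :
    Matrix.of (add a b).val = Matrix.of a + Matrix.of b := by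
  ext p q
  simp [add, FlopOp.eval]

@[simp] lemma flops_add (a b : Block ℝ k) : (add a b).flops = k ^ 2 := by simp [add, sq]

@[simp] lemma val_sub (a b : Block ℝ k) (p q : Fin k) :
    (sub a b).val p q = a p q - b p q := by
  simp [sub, FlopOp.eval]

@[simp] lemma flops_sub (a b : Block ℝ k) : (sub a b).flops = k ^ 2 := by simp [sub, sq]

@[simp] lemma val_neg (a : Block ℝ k) (p q : Fin k) : (neg a).val p q = -a p q := by
  simp [neg, FlopOp.eval]

@[simp] lemma flops_neg (a : Block ℝ k) : (neg a).flops = k ^ 2 := by simp [neg, sq]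

/-! ### The Gram–Schmidt method -/

lemma flops_gramSchmidtStep_le (T g : Block ℝ k) (j : Fin k) :
    (gramSchmidtStep T g j).flops ≤ 11 * k ^ 2 := by
  have hk : 1 ≤ k := j.pos
  simp only [gramSchmidtStep, Prog.flops_bind, Prog.flops_tab, Prog.flops_op, Prog.flops_pure,
    Finset.sum_const, Finset.card_univ, Fintype.card_fin, smul_eq_mul, mul_one, add_zero]
  have hdots : ∀ x y : Fin k → Fin k → ℝ, ∑ m, (dot (x m) (y m)).flops ≤ k * (2 * k) := by
    intro x y
    calc _ ≤ ∑ _m : Fin k, 2 * k := Finset.sum_le_sum fun m _ => flops_dot_le _ _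
      _ = _ := by simp
  refine (Nat.add_le_add (hdots _ _) (Nat.add_le_add (hdots _ _) (Nat.add_le_add_left
    (Nat.add_le_add (hdots _ _) (Nat.add_le_add_right (flops_dot_le _ _) _)) _))).trans ?_
  nlinarith

lemma flops_gramSchmidt_le (T : Block ℝ k) : (gramSchmidt T).flops ≤ 11 * k ^ 3 := by
  refine (Prog.flops_loop_le _ (fun _ => 11 * k ^ 2)
    (fun s i => flops_gramSchmidtStep_le _ _ _) _).trans (le_of_eq ?_)
  simp
  ring

/-- The state of the Gram–Schmidt method after `j` steps: the first `j` columns are orthonormal for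
the inner product given by `T`, the others are zero, and the matrix is upper triangular. -/
structure IsPartialGramSchmidt (T : Matrix (Fin k) (Fin k) ℝ) (j : ℕ)
    (g : Matrix (Fin k) (Fin k) ℝ) : Prop where
  gram : g.transpose * T * g = Matrix.diagonal fun q : Fin k => if (q : ℕ) < j then 1 else 0
  zero : ∀ m q : Fin k, j ≤ q → g m q = 0
  upper : ∀ m q : Fin k, q < m → g m q = 0

open Matrix in
/-- Each step of the Gram–Schmidt method appends a column. The norm it divides by is nonzero, since
`v = e_j - u` where `u` is a combination of columns that vanish in the row `j`. -/
lemma isPartialGramSchmidt_step {T : Matrix (Fin k) (Fin k) ℝ} (hT : T.PosDef) (j : Fin k)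
    (g : Block ℝ k) (h : IsPartialGramSchmidt T j (Matrix.of g)) :
    IsPartialGramSchmidt T (j + 1) (Matrix.of (gramSchmidtStep T g j).val) := by
  set g' : Matrix (Fin k) (Fin k) ℝ := Matrix.of g with hg'
  set c : Fin k → ℝ := g'ᵀ *ᵥ (T *ᵥ Pi.single j 1) with hc
  set u : Fin k → ℝ := g' *ᵥ c with hu
  set v : Fin k → ℝ := Pi.single j 1 - u with hv
  set s : ℝ := Real.sqrt (v ⬝ᵥ T *ᵥ v) with hs
  have hval : (gramSchmidtStep T g j).val = fun m q => if q = j then v m / s else g m q := by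
    have hcv : (fun i => ∑ m, g m i * T m j) = c := by
      funext i
      simp [hc, hg', Matrix.mulVec, dotProduct]
    have hvm : ∀ m, (if m = j then (1 : ℝ) else 0) - ∑ i, g m i * c i = v m := by
      intro m
      simp [hv, hu, hg', Matrix.mulVec, dotProduct, Pi.single_apply]
    simp only [gramSchmidtStep, Prog.val_bind, Prog.val_tab, val_dot, Prog.val_op, FlopOp.eval,
      Prog.val_pure, hcv, hvm]
    rfl
  have hTs : Tᵀ = T := hT.isHermitian
  have hvj : v j = 1 := by
    have : u j = 0 := by
      simp only [hu, Matrix.mulVec, dotProduct]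
      refine Finset.sum_eq_zero fun i _ => ?_
      rcases lt_or_ge i j with hij | hij
      · rw [h.upper j i hij, zero_mul]
      · rw [h.zero j i hij, zero_mul]
    simp [hv, this]
  have hv0 : v ≠ 0 := fun h0 => by simp [h0] at hvj
  have hpos : 0 < v ⬝ᵥ T *ᵥ v := by simpa using hT.dotProduct_mulVec_pos hv0
  have hspos : 0 < s := Real.sqrt_pos.2 hpos
  have hss : s * s = v ⬝ᵥ T *ᵥ v := Real.mul_self_sqrt hpos.le
  have hvlow : ∀ m, j < m → v m = 0 := by
    intro m hm
    have : u m = 0 := by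
      simp only [hu, Matrix.mulVec, dotProduct]
      refine Finset.sum_eq_zero fun i _ => ?_
      rcases lt_or_ge i j with hij | hij
      · rw [h.upper m i (hij.trans hm), zero_mul]
      · rw [h.zero m i hij, zero_mul]
    simp [hv, this, hm.ne']
  -- the columns found so far are orthogonal to `v`
  have horth : g'ᵀ *ᵥ (T *ᵥ v) = 0 := by
    have hcc : (diagonal fun q : Fin k => if (q : ℕ) < j then (1 : ℝ) else 0) *ᵥ c = c := by
      funext q
      rw [mulVec_diagonal]
      split_ifs with hq
      · simp
      · have : c q = 0 := by
          simp only [hc, Matrix.mulVec, dotProduct]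
          exact Finset.sum_eq_zero fun i _ => by
            rw [transpose_apply, h.zero i q (not_lt.1 hq), zero_mul]
        simp [this]
    rw [hv, mulVec_sub, mulVec_sub, ← hc, hu]
    rw [mulVec_mulVec, mulVec_mulVec, h.gram, hcc, sub_self]
  set g'' : Matrix (Fin k) (Fin k) ℝ := Matrix.of (gramSchmidtStep T g j).val with hg''
  have hcolj : g''ᵀ j = s⁻¹ • v := by
    funext m
    simp [hg'', hval, div_eq_inv_mul]
  have hcol : ∀ q, q ≠ j → g''ᵀ q = g'ᵀ q := by
    intro q hq
    funext m
    simp [hg'', hval, hq, hg']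
  have hentry : ∀ (x : Matrix (Fin k) (Fin k) ℝ) p q,
      (xᵀ * T * x) p q = xᵀ p ⬝ᵥ T *ᵥ xᵀ q := by
    intro x p q
    rw [Matrix.mul_assoc]
    simp [Matrix.mul_apply, dotProduct, Matrix.mulVec]
  have horth' : ∀ q, g'ᵀ q ⬝ᵥ T *ᵥ v = 0 := fun q => congrFun horth q
  have hsymm : ∀ x y : Fin k → ℝ, x ⬝ᵥ T *ᵥ y = y ⬝ᵥ T *ᵥ x := by
    intro x y
    rw [dotProduct_mulVec, ← mulVec_transpose, hTs, dotProduct_comm]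
  refine ⟨?_, fun m q hq => ?_, fun m q hq => ?_⟩
  · ext p q
    rw [hentry]
    by_cases hp : p = j
    · by_cases hq : q = j
      · subst hp hq
        rw [hcolj, mulVec_smul, dotProduct_smul, smul_dotProduct, ← hss]
        simp
        field_simp
      · rw [hp, hcolj, hcol q hq, smul_dotProduct, hsymm, horth', diagonal_apply_ne _ (Ne.symm hq)]
        simp
    · by_cases hq : q = j
      · rw [hq, hcolj, hcol p hp, mulVec_smul, dotProduct_smul, horth', diagonal_apply_ne _ hp]
        simp
      · rw [hcol p hp, hcol q hq, ← hentry, h.gram]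
        by_cases hpq : p = q
        · subst hpq
          have : (p : ℕ) ≠ j := fun hh => hp (Fin.ext hh)
          rw [diagonal_apply_eq, diagonal_apply_eq]
          exact if_congr (by omega) rfl rfl
        · rw [diagonal_apply_ne _ hpq, diagonal_apply_ne _ hpq]
  · have hqj : q ≠ j := fun hh => by subst hh; omega
    rw [← transpose_apply g'' q m, hcol q hqj]
    exact h.zero m q (by omega)
  · rw [← transpose_apply g'' q m]
    by_cases hqj : q = j
    · rw [hqj, hcolj, Pi.smul_apply, hvlow m (hqj ▸ hq), smul_zero]
    · rw [hcol q hqj]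
      exact h.upper m q hq

/-- The Gram–Schmidt method orthonormalizes the standard basis for a positive definite `T`. -/
lemma gramSchmidt_gram {T : Matrix (Fin k) (Fin k) ℝ} (hT : T.PosDef) :
    (Matrix.of (gramSchmidt T).val).transpose * T * Matrix.of (gramSchmidt T).val = 1 := by
  have h := Prog.loop_invariant (gramSchmidtStep T)
    (fun j g => IsPartialGramSchmidt T j (Matrix.of g))
    (fun j g hg => isPartialGramSchmidt_step hT j g hg) (fun _ _ => 0)
    ⟨by ext p q; simp [Matrix.mul_apply], fun _ _ _ => rfl, fun _ _ _ => rfl⟩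
  refine Eq.trans h.gram ?_
  simp

end Block

/-! ### Operations on block-sparse matrices -/

/-- The matrix of a possibly missing block, which is zero if the block is missing. -/
def Block.ofOption {k : ℕ} : Option (Block ℝ k) → Matrix (Fin k) (Fin k) ℝ
  | none => 0
  | some a => Matrix.of a

namespace SparseMat

variable {n k : ℕ}

@[simp] lemma toMatrix_apply (A : SparseMat ℝ n k) (i j : Fin n) (p q : Fin k) :
    A.toMatrix (i, p) (j, q) = Block.ofOption (A i j) p q := by
  cases h : A i j <;> simp [toMatrix, Block.ofOption, h]

lemma isSome_of_toMatrix_ne {A : SparseMat ℝ n k} {i j : Fin n} {p q : Fin k}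
    (h : A.toMatrix (i, p) (j, q) ≠ 0) : (A i j).isSome := by
  cases h' : A i j
  · simp [h', Block.ofOption] at h
  · rfl

@[simp] lemma toMatrix_transpose (A : SparseMat ℝ n k) :
    A.transpose.toMatrix = A.toMatrix.transpose := by
  ext ⟨i, p⟩ ⟨j, q⟩
  rw [Matrix.transpose_apply, toMatrix_apply, toMatrix_apply, transpose]
  cases A j i <;> rfl

@[simp] lemma isSome_transpose (A : SparseMat ℝ n k) (i j : Fin n) :
    (A.transpose i j).isSome = (A j i).isSome := by
  simp [transpose]

/-- The orthogonal projection onto the block rows whose indices satisfy `p`. -/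
def proj (k : ℕ) (p : Fin n → Prop) [DecidablePred p] : Matrix (Fin n × Fin k) (Fin n × Fin k) ℝ :=
  Matrix.diagonal fun x => if p x.1 then 1 else 0

lemma toMatrix_restrict (R T : Finset ℕ) (A : SparseMat ℝ n k) :
    (A.restrict R T).toMatrix =
      proj k (fun i : Fin n => (i : ℕ) + 1 ∈ R) * A.toMatrix *
        proj k (fun j : Fin n => (j : ℕ) + 1 ∈ T) := by
  ext ⟨i, p⟩ ⟨j, q⟩
  rw [proj, proj, Matrix.mul_diagonal, Matrix.diagonal_mul, toMatrix_apply, toMatrix_apply, restrict]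
  by_cases hi : (i : ℕ) + 1 ∈ R <;> by_cases hj : (j : ℕ) + 1 ∈ T <;>
    simp [hi, hj, Block.ofOption]

lemma isSome_restrict {R T : Finset ℕ} {A : SparseMat ℝ n k} {i j : Fin n} :
    (A.restrict R T i j).isSome ↔
      ((i : ℕ) + 1 ∈ R ∧ (j : ℕ) + 1 ∈ T) ∧ (A i j).isSome := by
  unfold restrict
  split_ifs with h <;> simp [h]

/-- Adding the product of two possibly missing blocks to a possibly missing block. -/
def accumulate {V : Type} [Zero V] (a b s : Option (Block V k)) : Prog V (Option (Block V k)) :=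
  match a, b with
  | some a, some b => do
    let c ← Block.mul a b
    match s with
    | none => pure (some c)
    | some t => do
      let r ← Block.add t c
      pure (some r)
  | _, _ => pure s

lemma mul_eq (A B : SparseMat ℝ n k) :
    A.mul B = Prog.tab fun i => Prog.tab fun j =>
      Prog.loop (fun s m => accumulate (A i m) (B m j) s) none := by
  unfold mul
  congr 1
  funext i
  congr 1
  funext j
  congr 1
  funext s m
  cases A i m <;> cases B m j <;> cases s <;> rfl

lemma val_mul_apply (A B : SparseMat ℝ n k) (i j : Fin n) :
    (A.mul B).val i j = (Prog.loop (fun s m => accumulate (A i m) (B m j) s) none).val := by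
  rw [mul_eq]
  exact Prog.val_tab_tab _ i j

lemma ofOption_accumulate (a b s : Option (Block ℝ k)) :
    Block.ofOption (accumulate a b s).val =
      Block.ofOption s + Block.ofOption a * Block.ofOption b := by
  cases a <;> cases b <;> cases s <;> simp [accumulate, Block.ofOption]

lemma isSome_accumulate {a b s : Option (Block ℝ k)} (h : (accumulate a b s).val.isSome) :
    s.isSome ∨ (a.isSome ∧ b.isSome) := by
  cases a <;> cases b <;> cases s <;> simp_all [accumulate]

lemma flops_accumulate_le (a b s : Option (Block ℝ k)) :
    (accumulate a b s).flops ≤ if a.isSome ∧ b.isSome then 3 * k ^ 3 else 0 := by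
  have hk : k ^ 2 ≤ k ^ 3 := by
    rcases Nat.eq_zero_or_pos k with rfl | hk
    · simp
    · exact Nat.pow_le_pow_right hk (by norm_num)
  rcases a with _ | a <;> rcases b with _ | b <;> try simp [accumulate]
  have := Block.flops_mul_le a b
  cases s <;> simp <;> omega

lemma ofOption_loop_accumulate {r : ℕ} (a b : Fin r → Option (Block ℝ k))
    (s : Option (Block ℝ k)) :
    Block.ofOption (Prog.loop (fun s m => accumulate (a m) (b m) s) s).val =
      Block.ofOption s + ∑ m, Block.ofOption (a m) * Block.ofOption (b m) := by
  induction r generalizing s with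
  | zero => simp [Prog.loop]
  | succ r ih =>
    simp only [Prog.loop, Prog.val_bind]
    rw [ih (fun m => a m.succ) (fun m => b m.succ), ofOption_accumulate, Fin.sum_univ_succ,
      add_assoc]

@[simp] lemma toMatrix_mul (A B : SparseMat ℝ n k) :
    (A.mul B).val.toMatrix = A.toMatrix * B.toMatrix := by
  ext ⟨i, p⟩ ⟨j, q⟩
  rw [toMatrix_apply, val_mul_apply, ofOption_loop_accumulate,
    Matrix.mul_apply, Fintype.sum_prod_type]
  simp [Matrix.add_apply, Matrix.sum_apply, Matrix.mul_apply, Block.ofOption]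

lemma exists_of_isSome_mul {A B : SparseMat ℝ n k} {i j : Fin n}
    (h : ((A.mul B).val i j).isSome) : ∃ m, (A i m).isSome ∧ (B m j).isSome := by
  rw [val_mul_apply] at h
  exact Prog.loop_invariant (fun s m => accumulate (A i m) (B m j) s)
    (fun _ s => s.isSome → ∃ m, (A i m).isSome ∧ (B m j).isSome)
    (fun m s ih hs => (isSome_accumulate hs).elim ih fun h => ⟨m, h⟩) none (by simp) h

@[simp] lemma toMatrix_sub (A B : SparseMat ℝ n k) :
    (A.sub B).val.toMatrix = A.toMatrix - B.toMatrix := by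
  ext ⟨i, p⟩ ⟨j, q⟩
  rw [Matrix.sub_apply, toMatrix_apply, toMatrix_apply, toMatrix_apply,
    show (A.sub B).val i j = _ from Prog.val_tab_tab _ i j]
  cases A i j <;> cases B i j <;> simp [Block.ofOption]

lemma isSome_sub (A B : SparseMat ℝ n k) (i j : Fin n) :
    ((A.sub B).val i j).isSome ↔ (A i j).isSome ∨ (B i j).isSome := by
  rw [show (A.sub B).val i j = _ from Prog.val_tab_tab _ i j]
  cases A i j <;> cases B i j <;> simp

@[simp] lemma toMatrix_neg (A : SparseMat ℝ n k) : A.neg.val.toMatrix = -A.toMatrix := by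
  ext ⟨i, p⟩ ⟨j, q⟩
  rw [Matrix.neg_apply, toMatrix_apply, toMatrix_apply,
    show A.neg.val i j = _ from Prog.val_tab_tab _ i j]
  cases A i j <;> simp [Block.ofOption]

@[simp] lemma isSome_neg (A : SparseMat ℝ n k) (i j : Fin n) :
    (A.neg.val i j).isSome = (A i j).isSome := by
  rw [show A.neg.val i j = _ from Prog.val_tab_tab _ i j]
  cases A i j <;> simp

lemma val_orth (A : SparseMat ℝ n k) (i j : Fin n) :
    A.orth.val i j = if i = j then (A i i).map fun a => (Block.gramSchmidt a).val else none := by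
  rw [show A.orth.val i j = _ from Prog.val_tab_tab _ i j]
  cases A i i
  · simp
  · by_cases h : i = j <;> simp [h]

lemma isSome_orth {A : SparseMat ℝ n k} {i j : Fin n} :
    (A.orth.val i j).isSome ↔ i = j ∧ (A i i).isSome := by
  rw [val_orth]
  split_ifs with h <;> simp [h]

/-- The block in position `(i, j)` of a partitioned matrix. -/
def block (i j : Fin n) (X : Matrix (Fin n × Fin k) (Fin n × Fin k) ℝ) :
    Matrix (Fin k) (Fin k) ℝ :=
  X.submatrix (Prod.mk i) (Prod.mk j)

lemma block_mul (i j : Fin n) (X Y : Matrix (Fin n × Fin k) (Fin n × Fin k) ℝ) :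
    block i j (X * Y) = ∑ m, block i m X * block m j Y := by
  ext p q
  simp [block, Matrix.mul_apply, Matrix.sum_apply, Fintype.sum_prod_type]

lemma block_toMatrix (A : SparseMat ℝ n k) (i j : Fin n) :
    block i j A.toMatrix = Block.ofOption (A i j) := by
  ext p q
  simp [block]

/-- For a block diagonal matrix `A` whose stored diagonal blocks are positive definite, the
orthonormalization `G` of `A` satisfies `Gᵀ A G = I` on the stored block rows. -/
lemma orth_gram (A : SparseMat ℝ n k) (p : Fin n → Prop) [DecidablePred p]
    (hdiag : ∀ i j, (A i j).isSome → i = j) (hp : ∀ i, (A i i).isSome ↔ p i)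
    (hpos : ∀ i, p i → (block i i A.toMatrix).PosDef) :
    A.orth.val.toMatrix.transpose * A.toMatrix * A.orth.val.toMatrix = proj k p := by
  have hG : ∀ i j, i ≠ j → block i j A.orth.val.toMatrix = 0 := by
    intro i j h
    rw [block_toMatrix, val_orth, if_neg h]
    rfl
  have hblock : ∀ i j, block i j
      (A.orth.val.toMatrix.transpose * A.toMatrix * A.orth.val.toMatrix) =
      (block i i A.orth.val.toMatrix).transpose * block i j A.toMatrix *
        block j j A.orth.val.toMatrix := by
    intro i j
    rw [block_mul, Finset.sum_eq_single j (fun m _ hm => by rw [hG m j hm, Matrix.mul_zero])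
      (by simp), block_mul, Finset.sum_eq_single i]
    · rfl
    · intro m _ hm
      change (block m i A.orth.val.toMatrix).transpose * _ = 0
      rw [hG m i hm, Matrix.transpose_zero, Matrix.zero_mul]
    · simp
  have key : ∀ i j, block i j
      (A.orth.val.toMatrix.transpose * A.toMatrix * A.orth.val.toMatrix) =
      block i j (proj k p) := by
    intro i j
    rw [hblock]
    by_cases hij : i = j
    · subst hij
      by_cases hi : p i
      · obtain ⟨a, ha⟩ := Option.isSome_iff_exists.1 ((hp i).2 hi)
        have h := hpos i hi
        rw [block_toMatrix, ha] at h
        rw [block_toMatrix, block_toMatrix A, val_orth, if_pos rfl, ha]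
        refine (Block.gramSchmidt_gram h).trans ?_
        ext x y
        simp [block, proj, hi, Matrix.diagonal_apply, Matrix.one_apply]
      · have : block i i A.orth.val.toMatrix = 0 := by
          have : A i i = none := by simpa using mt (hp i).1 hi
          rw [block_toMatrix, val_orth, if_pos rfl, this]
          rfl
        rw [this, Matrix.mul_zero]
        ext x y
        simp [block, proj, hi, Matrix.diagonal_apply]
    · have : A i j = none := by simpa using mt (hdiag i j) hij
      rw [block_toMatrix _ i j, this]
      ext x y
      simp [Block.ofOption, block, proj, hij]
  ext ⟨i, x⟩ ⟨j, y⟩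
  exact congrFun (congrFun (key i j) x) y

/-! ### Costs of operations on block-sparse matrices -/

lemma flops_mul_le (A B : SparseMat ℝ n k) :
    (A.mul B).flops ≤
      ∑ i, ∑ m, ∑ j, if (A i m).isSome ∧ (B m j).isSome then 3 * k ^ 3 else 0 := by
  rw [mul_eq, Prog.flops_tab]
  refine Finset.sum_le_sum fun i _ => ?_
  rw [Prog.flops_tab, Finset.sum_comm]
  exact Finset.sum_le_sum fun j _ =>
    Prog.flops_loop_le (fun s m => accumulate (A i m) (B m j) s) _
      (fun s m => flops_accumulate_le (A i m) (B m j) s) none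

/-- The cost of a product with at most `a` stored blocks in each row of the left factor and at most
`b` stored blocks in each row of the right factor. -/
lemma flops_mul_le_of_rows (A B : SparseMat ℝ n k) (a b : ℕ)
    (hA : ∀ i, (Finset.univ.filter fun m => (A i m).isSome = true).card ≤ a)
    (hB : ∀ m, (Finset.univ.filter fun j => (B m j).isSome = true).card ≤ b) :
    (A.mul B).flops ≤ n * (a * b) * (3 * k ^ 3) := by
  calc _ ≤ _ := flops_mul_le A B
    _ ≤ ∑ _i : Fin n, a * (b * (3 * k ^ 3)) := by
        refine Finset.sum_le_sum fun i _ => ?_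
        calc _ ≤ ∑ m, if (A i m).isSome = true then b * (3 * k ^ 3) else 0 := by
              refine Finset.sum_le_sum fun m _ => ?_
              split_ifs with h
              · simp only [h, true_and, ← Finset.sum_filter, Finset.sum_const, smul_eq_mul]
                exact Nat.mul_le_mul_right _ (hB m)
              · simp [h]
          _ ≤ _ := by
              simp only [← Finset.sum_filter, Finset.sum_const, smul_eq_mul]
              exact Nat.mul_le_mul_right _ (hA i)
    _ = _ := by simp; ring

/-- The cost of a product with at most `a` stored blocks in each column of the left factor and at
most `b` stored blocks in each row of the right factor. -/
lemma flops_mul_le_of_cols (A B : SparseMat ℝ n k) (a b : ℕ)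
    (hA : ∀ m, (Finset.univ.filter fun i => (A i m).isSome = true).card ≤ a)
    (hB : ∀ m, (Finset.univ.filter fun j => (B m j).isSome = true).card ≤ b) :
    (A.mul B).flops ≤ n * (a * b) * (3 * k ^ 3) := by
  calc _ ≤ _ := flops_mul_le A B
    _ = _ := Finset.sum_comm
    _ ≤ ∑ _m : Fin n, a * (b * (3 * k ^ 3)) := by
        refine Finset.sum_le_sum fun m _ => ?_
        calc _ ≤ ∑ i, if (A i m).isSome = true then b * (3 * k ^ 3) else 0 := by
              refine Finset.sum_le_sum fun i _ => ?_
              split_ifs with h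
              · simp only [h, true_and, ← Finset.sum_filter, Finset.sum_const, smul_eq_mul]
                exact Nat.mul_le_mul_right _ (hB m)
              · simp [h]
          _ ≤ _ := by
              simp only [← Finset.sum_filter, Finset.sum_const, smul_eq_mul]
              exact Nat.mul_le_mul_right _ (hA m)
    _ = _ := by simp; ring

lemma flops_sub_le (A B : SparseMat ℝ n k) (b : ℕ)
    (hB : ∀ i, (Finset.univ.filter fun j => (B i j).isSome = true).card ≤ b) :
    (A.sub B).flops ≤ n * b * k ^ 2 := by
  calc (A.sub B).flops ≤ ∑ i, ∑ j, if (B i j).isSome = true then k ^ 2 else 0 := by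
        rw [sub, Prog.flops_tab]
        refine Finset.sum_le_sum fun i _ => ?_
        rw [Prog.flops_tab]
        refine Finset.sum_le_sum fun j _ => ?_
        cases A i j <;> cases B i j <;> simp
    _ ≤ ∑ _i : Fin n, b * k ^ 2 := by
        refine Finset.sum_le_sum fun i _ => ?_
        simp only [← Finset.sum_filter, Finset.sum_const, smul_eq_mul]
        exact Nat.mul_le_mul_right _ (hB i)
    _ = _ := by simp; ring

lemma flops_neg_le (A : SparseMat ℝ n k) (a : ℕ)
    (hA : ∀ i, (Finset.univ.filter fun j => (A i j).isSome = true).card ≤ a) :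
    A.neg.flops ≤ n * a * k ^ 2 := by
  calc A.neg.flops ≤ ∑ i, ∑ j, if (A i j).isSome = true then k ^ 2 else 0 := by
        rw [neg, Prog.flops_tab]
        refine Finset.sum_le_sum fun i _ => ?_
        rw [Prog.flops_tab]
        refine Finset.sum_le_sum fun j _ => ?_
        cases A i j <;> simp
    _ ≤ ∑ _i : Fin n, a * k ^ 2 := by
        refine Finset.sum_le_sum fun i _ => ?_
        simp only [← Finset.sum_filter, Finset.sum_const, smul_eq_mul]
        exact Nat.mul_le_mul_right _ (hA i)
    _ = _ := by simp; ring

lemma flops_orth_le (A : SparseMat ℝ n k) : A.orth.flops ≤ n * (11 * k ^ 3) := by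
  calc A.orth.flops ≤ ∑ i : Fin n, ∑ j, if i = j then 11 * k ^ 3 else 0 := by
        rw [orth, Prog.flops_tab]
        refine Finset.sum_le_sum fun i _ => ?_
        rw [Prog.flops_tab]
        refine Finset.sum_le_sum fun j _ => ?_
        rcases A i i with _ | a
        · simp
        · by_cases h : i = j
          · simpa [h] using Block.flops_gramSchmidt_le a
          · simp [h]
    _ = _ := by simp

end SparseMat

/-! ### The dyadic tree -/

/-- The level of a positive integer in the pyramid: the exponent of the largest power of two that
divides it, plus one. -/
def dyadicLevel (i : ℕ) : ℕ := padicValNat 2 i + 1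

lemma dyadicLevel_odd_mul (l r : ℕ) (hl : 1 ≤ l) (hr : 1 ≤ r) :
    dyadicLevel (2 ^ (l - 1) * (2 * r - 1)) = l := by
  have h1 : padicValNat 2 (2 * r - 1) = 0 :=
    padicValNat.eq_zero_of_not_dvd (by omega)
  rw [dyadicLevel, padicValNat.mul (by positivity) (by omega), padicValNat.prime_pow, h1]
  omega

/-- A positive integer is `2 ^ (l - 1) * (2 * r - 1)`, where `l` is its level and `r - 1` its
quotient by `2 ^ l`. -/
lemma eq_odd_mul {i : ℕ} (hi : 1 ≤ i) :
    i = 2 ^ (dyadicLevel i - 1) * (2 * (i / 2 ^ dyadicLevel i + 1) - 1) := by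
  obtain ⟨m, hm⟩ : 2 ^ padicValNat 2 i ∣ i := pow_padicValNat_dvd
  have hodd : ¬ 2 ∣ m := by
    rintro ⟨c, rfl⟩
    have := pow_succ_padicValNat_not_dvd (p := 2) (n := i) (by omega)
    exact this ⟨c, by rw [pow_succ, mul_assoc, ← hm]⟩
  have hq : i / 2 ^ dyadicLevel i = m / 2 := by
    rw [dyadicLevel, pow_succ, ← Nat.div_div_eq_div_mul]
    nth_rewrite 1 [hm]
    rw [Nat.mul_div_cancel_left _ (by positivity)]
  rw [hq, dyadicLevel, Nat.add_sub_cancel]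
  nth_rewrite 1 [hm]
  congr 1
  omega

lemma mem_pyr {i r l : ℕ} (hl : 1 ≤ l) (hr : 1 ≤ r) :
    i ∈ pyr r l ↔ 1 ≤ i ∧ dyadicLevel i = l ∧ i / 2 ^ l + 1 = r := by
  rw [pyr, Finset.mem_singleton]
  constructor
  · rintro rfl
    have h0 : 1 ≤ 2 ^ (l - 1) * (2 * r - 1) := Nat.mul_pos (by positivity) (by omega)
    refine ⟨h0, dyadicLevel_odd_mul l r hl hr, ?_⟩
    obtain ⟨l, rfl⟩ : ∃ m, l = m + 1 := ⟨l - 1, by omega⟩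
    rw [Nat.add_sub_cancel, pow_succ, ← Nat.div_div_eq_div_mul,
      Nat.mul_div_cancel_left _ (by positivity)]
    omega
  · rintro ⟨h0, rfl, rfl⟩
    exact eq_odd_mul h0

/-- The pyramid `I'_{r,l}` consists of the integers strictly between `(r - 1) 2^l` and `r 2^l`. -/
lemma mem_pyr' {i r l : ℕ} (hr : 1 ≤ r) :
    i ∈ pyr' r l ↔ (r - 1) * 2 ^ l < i ∧ i < r * 2 ^ l := by
  induction l generalizing r with
  | zero => simp [pyr']; omega
  | succ l ih =>
    obtain ⟨r, rfl⟩ : ∃ s, r = s + 1 := ⟨r - 1, by omega⟩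
    rw [pyr', Finset.mem_union, Finset.mem_union, ih (by omega), ih (by omega), pyr,
      Finset.mem_singleton]
    have e1 : 2 * (r + 1) - 1 = 2 * r + 1 := by omega
    have e2 : 2 * (r + 1) = 2 * r + 2 := by omega
    rw [e1, e2]
    simp only [Nat.add_sub_cancel, pow_succ]
    have hp : 0 < 2 ^ l := by positivity
    generalize 2 ^ l = x at *
    have a1 : x * (2 * r + 1) = 2 * (r * x) + x := by ring
    have a2 : 2 * r * x = 2 * (r * x) := by ring
    have a3 : (2 * r + 1) * x = 2 * (r * x) + x := by ring
    have a4 : (2 * r + 2) * x = 2 * (r * x) + 2 * x := by ring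
    have a5 : r * (x * 2) = 2 * (r * x) := by ring
    have a6 : (r + 1) * (x * 2) = 2 * (r * x) + 2 * x := by ring
    rw [a1, a2, a3, a4, a5, a6]
    omega

lemma dyadicLevel_le {i N : ℕ} (hi : 1 ≤ i) (hiN : i < 2 ^ N) : dyadicLevel i ≤ N := by
  have h : 2 ^ padicValNat 2 i ≤ i := Nat.le_of_dvd hi pow_padicValNat_dvd
  have := (Nat.pow_lt_pow_iff_right (by norm_num : 1 < 2)).1 (h.trans_lt hiN)
  rw [dyadicLevel]
  omega

lemma div_succ_le_two_pow {i l N : ℕ} (hl : l ≤ N) (hi : i < 2 ^ N) :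
    i / 2 ^ l + 1 ≤ 2 ^ (N - l) := by
  rw [Nat.succ_le_iff, Nat.div_lt_iff_lt_mul (by positivity), ← pow_add, Nat.sub_add_cancel hl]
  exact hi

lemma mem_pyrLevel {i l N : ℕ} (hl : 1 ≤ l) (hi : 1 ≤ i) (hiN : i < 2 ^ N) :
    i ∈ pyrLevel N l ↔ dyadicLevel i = l := by
  simp only [pyrLevel, Finset.mem_biUnion, Finset.mem_Icc]
  constructor
  · rintro ⟨r, hr, h⟩
    exact ((mem_pyr hl hr.1).1 h).2.1
  · rintro rfl
    exact ⟨i / 2 ^ dyadicLevel i + 1, ⟨Nat.le_add_left _ _, div_succ_le_two_pow (dyadicLevel_le hi hiN) hiN⟩,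
      (mem_pyr hl (Nat.le_add_left _ _)).2 ⟨hi, rfl, rfl⟩⟩

lemma mem_pyrBelow {i l N : ℕ} (hi : 1 ≤ i) (hiN : i < 2 ^ N) :
    i ∈ pyrBelow N l ↔ dyadicLevel i < l := by
  simp only [pyrBelow, Finset.mem_biUnion, Finset.mem_Icc]
  constructor
  · rintro ⟨m, hm, h⟩
    rw [mem_pyrLevel hm.1 hi hiN] at h
    omega
  · intro h
    have : 1 ≤ dyadicLevel i := by simp [dyadicLevel]
    exact ⟨dyadicLevel i, ⟨this, by omega⟩, (mem_pyrLevel this hi hiN).2 rfl⟩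

/-- The integer `i` is `j` or a descendant of `j` in the dyadic tree: its level is at most the
level `l` of `j`, and `i` and `j` lie in the same interval of length `2^l`. -/
def DyadicDesc (i j : ℕ) : Prop :=
  dyadicLevel i ≤ dyadicLevel j ∧ i / 2 ^ dyadicLevel j = j / 2 ^ dyadicLevel j

/-- The strict inequality `q 2^l < i` for the quotient `q` of `i` by `2^l` amounts to a bound on the
level of `i`. -/
lemma div_mul_lt_iff {i l : ℕ} (hi : 1 ≤ i) :
    i / 2 ^ l * 2 ^ l < i ↔ dyadicLevel i ≤ l := by
  have h1 : i / 2 ^ l * 2 ^ l ≤ i := Nat.div_mul_le_self _ _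
  have h2 : 2 ^ l ∣ i ↔ l ≤ padicValNat 2 i := padicValNat_dvd_iff_le (by omega)
  have h3 : i / 2 ^ l * 2 ^ l = i ↔ 2 ^ l ∣ i :=
    ⟨fun h => ⟨i / 2 ^ l, by rw [mul_comm, h]⟩, Nat.div_mul_cancel⟩
  rw [dyadicLevel]
  omega

lemma mem_VDPattern {i j N : ℕ} (hi : 1 ≤ i) (hj : 1 ≤ j) (hjN : j < 2 ^ N) :
    (i, j) ∈ VDPattern N ↔ DyadicDesc i j := by
  have hsub : ∀ l r, 1 ≤ r → (i ∈ pyr' r l ↔ dyadicLevel i ≤ l ∧ i / 2 ^ l + 1 = r) := by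
    intro l r hr
    obtain ⟨r, rfl⟩ : ∃ s, r = s + 1 := ⟨r - 1, by omega⟩
    have hp : 0 < 2 ^ l := by positivity
    rw [mem_pyr' hr, Nat.add_sub_cancel, ← div_mul_lt_iff hi]
    constructor
    · rintro ⟨h1, h2⟩
      have : i / 2 ^ l = r := Nat.div_eq_of_lt_le h1.le h2
      rw [this]
      exact ⟨h1, rfl⟩
    · rintro ⟨h1, h2⟩
      have h3 : i / 2 ^ l = r := by omega
      refine ⟨h3 ▸ h1, ?_⟩
      rw [← h3]
      exact Nat.lt_mul_of_div_lt (Nat.lt_succ_self _) hp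
  simp only [VDPattern, HDPattern, Finset.mem_image, Finset.mem_biUnion, Finset.mem_Icc,
    Prod.exists, Finset.mem_product, Prod.swap_prod_mk, Prod.mk.injEq]
  constructor
  · rintro ⟨_, _, ⟨l, hl, r, hr, hjr, hir⟩, rfl, rfl⟩
    obtain ⟨-, rfl, h3⟩ := (mem_pyr hl.1 hr.1).1 hjr
    obtain ⟨h4, h5⟩ := (hsub _ _ hr.1).1 hir
    exact ⟨h4, by omega⟩
  · rintro ⟨h1, h2⟩
    have hl := dyadicLevel_le hj hjN
    have hl1 : 1 ≤ dyadicLevel j := by simp [dyadicLevel]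
    exact ⟨j, i, ⟨dyadicLevel j, ⟨hl1, hl⟩, j / 2 ^ dyadicLevel j + 1,
      ⟨Nat.le_add_left _ _, div_succ_le_two_pow hl hjN⟩, (mem_pyr hl1 (Nat.le_add_left _ _)).2 ⟨hj, rfl, rfl⟩,
      (hsub _ _ (Nat.le_add_left _ _)).2 ⟨h1, by rw [h2]⟩⟩, rfl, rfl⟩

lemma mem_SDPattern {i j N : ℕ} (hi : 1 ≤ i) (hiN : i < 2 ^ N) (hj : 1 ≤ j) (hjN : j < 2 ^ N) :
    (i, j) ∈ SDPattern N ↔ DyadicDesc j i ∨ DyadicDesc i j := by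
  rw [SDPattern, Finset.mem_union, mem_VDPattern hi hj hjN, ← mem_VDPattern hj hi hiN]
  refine or_congr ?_ Iff.rfl
  simp [VDPattern]

namespace DyadicDesc

lemma refl (i : ℕ) : DyadicDesc i i := ⟨le_rfl, rfl⟩

lemma div_eq {i j l : ℕ} (h : DyadicDesc i j) (hl : dyadicLevel j ≤ l) : i / 2 ^ l = j / 2 ^ l := by
  obtain ⟨m, rfl⟩ := Nat.exists_eq_add_of_le hl
  rw [pow_add, ← Nat.div_div_eq_div_mul, h.2, Nat.div_div_eq_div_mul]

lemma trans {i m j : ℕ} (h₁ : DyadicDesc i m) (h₂ : DyadicDesc m j) : DyadicDesc i j :=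
  ⟨h₁.1.trans h₂.1, (h₁.div_eq h₂.1).trans h₂.2⟩

/-- Of two ancestors of the same node, the lower one is a descendant of the other one. -/
lemma of_common {i a j : ℕ} (h₁ : DyadicDesc i a) (h₂ : DyadicDesc i j)
    (h : dyadicLevel a ≤ dyadicLevel j) : DyadicDesc a j :=
  ⟨h, (h₁.div_eq h).symm.trans h₂.2⟩

lemma eq_of_level_eq {i j : ℕ} (hi : 1 ≤ i) (hj : 1 ≤ j) (h : DyadicDesc i j)
    (hl : dyadicLevel i = dyadicLevel j) : i = j := by
  rw [eq_odd_mul hi, eq_odd_mul hj, hl, h.2]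

/-- A node has at most one ancestor in each level. -/
lemma ancestor_unique {i j j' : ℕ} (hj : 1 ≤ j) (hj' : 1 ≤ j') (h : DyadicDesc i j)
    (h' : DyadicDesc i j') (hl : dyadicLevel j = dyadicLevel j') : j = j' :=
  (h.of_common h' hl.le).eq_of_level_eq hj hj' hl

end DyadicDesc

/-! ### Orthogonalization level by level -/

namespace SparseMat

variable {n k : ℕ}

lemma proj_congr {p q : Fin n → Prop} [DecidablePred p] [DecidablePred q] (h : ∀ i, p i ↔ q i) :
    proj k p = proj k q := by
  rw [proj, proj]
  congr 1
  funext x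
  exact if_congr (h x.1) rfl rfl

@[simp] lemma transpose_proj (p : Fin n → Prop) [DecidablePred p] :
    (proj k p).transpose = proj k p :=
  Matrix.diagonal_transpose _

lemma block_proj_self {p : Fin n → Prop} [DecidablePred p] {i : Fin n} (hi : p i) :
    block i i (proj k p) = 1 := by
  ext x y
  simp [block, proj, hi, Matrix.diagonal_apply, Matrix.one_apply]

lemma proj_mul_toMatrix {p : Fin n → Prop} [DecidablePred p] {A : SparseMat ℝ n k}
    (h : ∀ i j, (A i j).isSome → p i) : proj k p * A.toMatrix = A.toMatrix := by
  ext ⟨i, x⟩ ⟨j, y⟩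
  rw [proj, Matrix.diagonal_mul]
  by_cases h0 : A.toMatrix (i, x) (j, y) = 0
  · rw [h0, mul_zero]
  · rw [if_pos (h i j (isSome_of_toMatrix_ne h0)), one_mul]

lemma toMatrix_ofMatrix {I : Finset (ℕ × ℕ)} {S : Matrix (Fin n × Fin k) (Fin n × Fin k) ℝ}
    (hS : HasBlockPattern I S) : (ofMatrix I S).toMatrix = S := by
  ext ⟨i, p⟩ ⟨j, q⟩
  rw [toMatrix_apply, ofMatrix]
  split_ifs with h
  · rfl
  · exact (hS i j h p q).symm

lemma isSome_ofMatrix {I : Finset (ℕ × ℕ)} {S : Matrix (Fin n × Fin k) (Fin n × Fin k) ℝ}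
    {i j : Fin n} : (ofMatrix I S i j).isSome ↔ ((i : ℕ) + 1, (j : ℕ) + 1) ∈ I := by
  unfold ofMatrix
  split_ifs with h <;> simp [h]

/-- A diagonal block of `Wᵀ S W` is positive definite if the corresponding block of `W` is the
identity, as the block column of `W` is then injective. -/
lemma posDef_block {S W : Matrix (Fin n × Fin k) (Fin n × Fin k) ℝ} (hS : S.PosDef) {i : Fin n}
    (hW : block i i W = 1) : (block i i (W.transpose * S * W)).PosDef := by
  have hinj : Function.Injective (W.submatrix id (Prod.mk i)).mulVec := by
    intro x y hxy
    have h : ∀ z, (block i i W).mulVec z =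
        fun p => (W.submatrix id (Prod.mk i)).mulVec z (i, p) := fun z => rfl
    have hx := h x
    have hy := h y
    rw [hW, Matrix.one_mulVec] at hx hy
    rw [hx, hy, hxy]
  exact hS.conjTranspose_mul_mul_same hinj

end SparseMat

section Algebra

variable {ι : Type*} [Fintype ι] {S M D L F : Matrix ι ι ℝ}

open Matrix

/-- If `Mᵀ S M` is the projection `D`, then `L - M F` with `F = Mᵀ S L` is orthogonal to `M` for the
inner product given by `S`. -/
lemma orthogonal_complement (hM : Mᵀ * S * M = D) (hDF : D * F = F) (hF : F = Mᵀ * S * L) :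
    Mᵀ * S * (L - M * F) = 0 := by
  rw [Matrix.mul_sub, ← hF, ← Matrix.mul_assoc, hM, hDF, sub_self]

/-- The Schur complement is the Gramian of `L - M F`. -/
lemma schur_complement (hS : Sᵀ = S) (hL : Lᵀ = L) (hM : Mᵀ * S * M = D) (hDF : D * F = F)
    (hF : F = Mᵀ * S * L) : (L - M * F)ᵀ * S * (L - M * F) = L * S * L - Fᵀ * F := by
  have h0 := orthogonal_complement hM hDF hF
  have hFt : Fᵀ = L * S * M := by
    rw [hF, transpose_mul, transpose_mul, transpose_transpose, hS, hL, Matrix.mul_assoc]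
  rw [transpose_sub, hL, transpose_mul, Matrix.sub_mul, Matrix.sub_mul, Matrix.mul_assoc Fᵀ,
    Matrix.mul_assoc Fᵀ, h0, Matrix.mul_zero, sub_zero, Matrix.mul_sub, ← Matrix.mul_assoc, ← hFt]

/-- Appending the orthonormalized columns of `L - M F` to `M`. -/
lemma gram_append {G : Matrix ι ι ℝ} (hS : Sᵀ = S) (hL : Lᵀ = L) (hM : Mᵀ * S * M = D)
    (hDF : D * F = F) (hF : F = Mᵀ * S * L) (hLG : L * G = G)
    (hG : Gᵀ * (L * S * L - Fᵀ * F) * G = L) :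
    (M - M * F * G + G)ᵀ * S * (M - M * F * G + G) = D + L := by
  have h0 := orthogonal_complement hM hDF hF
  have h0' : (L - M * F)ᵀ * S * M = 0 := by
    have := congrArg transpose h0
    rwa [transpose_mul, transpose_mul, transpose_transpose, hS, transpose_zero,
      ← Matrix.mul_assoc] at this
  have e : M - M * F * G + G = M + (L - M * F) * G := by
    rw [Matrix.sub_mul, hLG]
    abel
  rw [← schur_complement hS hL hM hDF hF] at hG
  generalize L - M * F = W at *
  rw [e, transpose_add, transpose_mul, Matrix.add_mul, Matrix.add_mul, Matrix.mul_add,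
    Matrix.mul_add, hM, ← Matrix.mul_assoc, h0, Matrix.zero_mul, Matrix.mul_assoc Gᵀ,
    Matrix.mul_assoc Gᵀ, h0', Matrix.mul_zero, add_zero, zero_add, ← Matrix.mul_assoc, ← hG]
  simp only [Matrix.mul_assoc]

end Algebra

open SparseMat

section Tree

variable {N k : ℕ}

/-- The level of a block index, counted from zero. -/
def blockLevel (i : Fin (2 ^ N - 1)) : ℕ := dyadicLevel (i + 1)

/-- The relation "equal to or a descendant of" on block indices counted from zero. -/
def BlockDesc (i j : Fin (2 ^ N - 1)) : Prop := DyadicDesc (i + 1) (j + 1)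

lemma succ_lt_two_pow (i : Fin (2 ^ N - 1)) : (i : ℕ) + 1 < 2 ^ N := by
  have := i.isLt
  omega

lemma one_le_blockLevel (i : Fin (2 ^ N - 1)) : 1 ≤ blockLevel i := Nat.le_add_left _ _

lemma blockLevel_le (i : Fin (2 ^ N - 1)) : blockLevel i ≤ N :=
  dyadicLevel_le (Nat.le_add_left _ _) (succ_lt_two_pow i)

lemma succ_mem_pyrLevel {l : ℕ} (hl : 1 ≤ l) (i : Fin (2 ^ N - 1)) :
    (i : ℕ) + 1 ∈ pyrLevel N l ↔ blockLevel i = l :=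
  mem_pyrLevel hl (Nat.le_add_left _ _) (succ_lt_two_pow i)

lemma succ_mem_pyrBelow {l : ℕ} (i : Fin (2 ^ N - 1)) :
    (i : ℕ) + 1 ∈ pyrBelow N l ↔ blockLevel i < l :=
  mem_pyrBelow (Nat.le_add_left _ _) (succ_lt_two_pow i)

lemma succ_mem_VDPattern (i j : Fin (2 ^ N - 1)) :
    ((i : ℕ) + 1, (j : ℕ) + 1) ∈ VDPattern N ↔ BlockDesc i j :=
  mem_VDPattern (Nat.le_add_left _ _) (Nat.le_add_left _ _) (succ_lt_two_pow j)

lemma succ_mem_SDPattern (i j : Fin (2 ^ N - 1)) :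
    ((i : ℕ) + 1, (j : ℕ) + 1) ∈ SDPattern N ↔ BlockDesc j i ∨ BlockDesc i j :=
  mem_SDPattern (Nat.le_add_left _ _) (succ_lt_two_pow i) (Nat.le_add_left _ _) (succ_lt_two_pow j)

lemma BlockDesc.ancestor_unique {i j j' : Fin (2 ^ N - 1)} (h : BlockDesc i j)
    (h' : BlockDesc i j') (hl : blockLevel j = blockLevel j') : j = j' := by
  have := DyadicDesc.ancestor_unique (Nat.le_add_left _ _) (Nat.le_add_left _ _) h h' hl
  exact Fin.ext (by omega)

lemma BlockDesc.eq_of_level_eq {i j : Fin (2 ^ N - 1)} (h : BlockDesc i j)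
    (hl : blockLevel i = blockLevel j) : i = j :=
  BlockDesc.ancestor_unique (DyadicDesc.refl _) h hl

/-- Rows of vertically dyadic matrices have at most `N` blocks, one for each level. -/
lemma card_row_le (A : SparseMat ℝ (2 ^ N - 1) k) (i : Fin (2 ^ N - 1))
    (h : ∀ j, (A i j).isSome → BlockDesc i j) :
    (Finset.univ.filter fun j => (A i j).isSome = true).card ≤ N := by
  calc _ ≤ (Finset.Icc 1 N).card := by
        refine Finset.card_le_card_of_injOn blockLevel
          (fun j _ => by simpa using ⟨one_le_blockLevel j, blockLevel_le j⟩) ?_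
        intro j hj j' hj' hl
        simp only [Finset.coe_filter, Finset.mem_univ, true_and, Set.mem_ofPred_eq] at hj hj'
        exact (h j hj).ancestor_unique (h j' hj') hl
    _ = N := by simp

lemma card_row_le_one (A : SparseMat ℝ (2 ^ N - 1) k) (i : Fin (2 ^ N - 1)) {l : ℕ}
    (h : ∀ j, (A i j).isSome → BlockDesc i j ∧ blockLevel j = l) :
    (Finset.univ.filter fun j => (A i j).isSome = true).card ≤ 1 := by
  rw [Finset.card_le_one]
  intro j hj j' hj'
  simp only [Finset.mem_filter, Finset.mem_univ, true_and] at hj hj'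
  exact (h j hj).1.ancestor_unique (h j' hj').1 ((h j hj).2.trans (h j' hj').2.symm)

end Tree

section Algorithm

variable {N k : ℕ}

/-- The loop invariant of the algorithm: after the level `l`, the matrix `P` is vertically dyadic,
only has columns in the levels up to `l`, and orthonormalizes the block rows and columns of `S` in
these levels. -/
structure IsPartialOrthogonalization
    (S : Matrix (Fin (2 ^ N - 1) × Fin k) (Fin (2 ^ N - 1) × Fin k) ℝ) (l : ℕ)
    (P : SparseMat ℝ (2 ^ N - 1) k) : Prop where
  desc : ∀ i j, (P i j).isSome → BlockDesc i j
  level : ∀ i j, (P i j).isSome → blockLevel j ≤ l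
  gram : P.toMatrix.transpose * S * P.toMatrix = proj k fun i => blockLevel i ≤ l

variable {S : Matrix (Fin (2 ^ N - 1) × Fin k) (Fin (2 ^ N - 1) × Fin k) ℝ}

/-- The first level. -/
lemma isPartialOrthogonalization_orth (hS : HasBlockPattern (SDPattern N) S) (hpos : S.PosDef) :
    IsPartialOrthogonalization S 1
      ((ofMatrix (SDPattern N) S).restrict (pyrLevel N 1) (pyrLevel N 1)).orth.val := by
  set T := (ofMatrix (SDPattern N) S).restrict (pyrLevel N 1) (pyrLevel N 1) with hT
  have hTm : T.toMatrix = (proj k fun i => blockLevel i = 1).transpose * S *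
      proj k fun i => blockLevel i = 1 := by
    rw [hT, toMatrix_restrict, toMatrix_ofMatrix hS, proj_congr (succ_mem_pyrLevel le_rfl),
      transpose_proj]
  have hTs : ∀ i j, (T i j).isSome → i = j ∧ blockLevel i = 1 := by
    intro i j h
    rw [hT, isSome_restrict, isSome_ofMatrix, succ_mem_pyrLevel le_rfl, succ_mem_pyrLevel le_rfl,
      succ_mem_SDPattern] at h
    refine ⟨?_, h.1.1⟩
    rcases h.2 with h' | h'
    · exact (h'.eq_of_level_eq (h.1.2.trans h.1.1.symm)).symm
    · exact h'.eq_of_level_eq (h.1.1.trans h.1.2.symm)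
  have hTd : ∀ i, (T i i).isSome ↔ blockLevel i = 1 := by
    intro i
    rw [hT, isSome_restrict, isSome_ofMatrix, succ_mem_pyrLevel le_rfl, succ_mem_SDPattern]
    exact ⟨fun h => h.1.1, fun h => ⟨⟨h, h⟩, Or.inl (DyadicDesc.refl _)⟩⟩
  have hG := orth_gram T (fun i => blockLevel i = 1) (fun i j h => (hTs i j h).1) hTd (by
    intro i hi
    rw [hTm]
    exact posDef_block hpos (block_proj_self hi))
  have hLG : (proj k fun i => blockLevel i = 1) * T.orth.val.toMatrix = T.orth.val.toMatrix :=
    proj_mul_toMatrix fun i j h => (hTd i).1 (isSome_orth.1 h).2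
  refine ⟨fun i j h => ?_, fun i j h => ?_, ?_⟩
  · rw [(isSome_orth.1 h).1]
    exact DyadicDesc.refl _
  · rw [← (isSome_orth.1 h).1]
    exact ((hTd i).1 (isSome_orth.1 h).2).le
  · rw [hTm, ← Matrix.mul_assoc, ← Matrix.mul_assoc, ← Matrix.transpose_mul, hLG, Matrix.mul_assoc,
      hLG] at hG
    rw [hG]
    refine proj_congr fun i => ?_
    have := one_le_blockLevel i
    omega

/-- One level of the algorithm preserves the invariant and, as all products run over at most
`N` pairs of ancestors of each of the `2 ^ N - 1` nodes, has quasilinear cost. -/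
lemma dyadicStep_spec (hN : 1 ≤ N) (hS : HasBlockPattern (SDPattern N) S) (hpos : S.PosDef) {l : ℕ}
    {P : SparseMat ℝ (2 ^ N - 1) k} (hP : IsPartialOrthogonalization S l P) :
    IsPartialOrthogonalization S (l + 1)
      (dyadicStep N (ofMatrix (SDPattern N) S) (l + 1) P).val ∧
    (dyadicStep N (ofMatrix (SDPattern N) S) (l + 1) P).flops ≤
      25 * N * (2 ^ N - 1) * k ^ 3 := by
  have hl : 1 ≤ l + 1 := Nat.le_add_left _ _
  set S₀ := ofMatrix (SDPattern N) S with hS₀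
  set E := S₀.restrict (pyrBelow N (l + 1)) (pyrLevel N (l + 1)) with hE
  set F := (P.transpose.mul E).val with hF
  set A := (P.mul F).val with hA
  set Q := (F.transpose.mul F).val with hQ
  set R := S₀.restrict (pyrLevel N (l + 1)) (pyrLevel N (l + 1)) with hR
  set T := (R.sub Q).val with hT
  set G := T.orth.val with hG
  set B := (A.mul G).val with hB
  -- the blocks that are stored at the various stages
  have sE : ∀ i j, (E i j).isSome → BlockDesc i j ∧ blockLevel j = l + 1 := by
    intro i j h
    rw [hE, isSome_restrict, hS₀, isSome_ofMatrix, succ_mem_pyrLevel hl, succ_mem_pyrBelow,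
      succ_mem_SDPattern] at h
    refine ⟨h.2.resolve_left fun h' => ?_, h.1.2⟩
    have : blockLevel j ≤ blockLevel i := h'.1
    omega
  have sF : ∀ i j, (F i j).isSome → BlockDesc i j ∧ blockLevel i ≤ l ∧ blockLevel j = l + 1 := by
    intro a j h
    obtain ⟨i, h1, h2⟩ := exists_of_isSome_mul h
    rw [isSome_transpose] at h1
    have h3 := hP.level i a h1
    obtain ⟨h4, h5⟩ := sE i j h2
    refine ⟨(hP.desc i a h1).of_common h4 ?_, h3, h5⟩
    change blockLevel a ≤ blockLevel j
    omega
  have sA : ∀ i j, (A i j).isSome → BlockDesc i j ∧ blockLevel i ≤ l ∧ blockLevel j = l + 1 := by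
    intro i j h
    obtain ⟨m, h1, h2⟩ := exists_of_isSome_mul h
    obtain ⟨h3, h4, h5⟩ := sF m j h2
    exact ⟨(hP.desc i m h1).trans h3, (hP.desc i m h1).1.trans h4, h5⟩
  have sQ : ∀ i j, (Q i j).isSome → i = j ∧ blockLevel i = l + 1 := by
    intro i j h
    obtain ⟨m, h1, h2⟩ := exists_of_isSome_mul h
    rw [isSome_transpose] at h1
    obtain ⟨h3, -, h4⟩ := sF m i h1
    obtain ⟨h5, -, h6⟩ := sF m j h2
    exact ⟨h3.ancestor_unique h5 (h4.trans h6.symm), h4⟩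
  have sR : ∀ i j, (R i j).isSome ↔ i = j ∧ blockLevel i = l + 1 := by
    intro i j
    rw [hR, isSome_restrict, hS₀, isSome_ofMatrix, succ_mem_pyrLevel hl, succ_mem_pyrLevel hl,
      succ_mem_SDPattern]
    constructor
    · rintro ⟨⟨h1, h2⟩, h | h⟩
      · exact ⟨(h.eq_of_level_eq (h2.trans h1.symm)).symm, h1⟩
      · exact ⟨h.eq_of_level_eq (h1.trans h2.symm), h1⟩
    · rintro ⟨rfl, h⟩
      exact ⟨⟨h, h⟩, Or.inl (DyadicDesc.refl _)⟩
  have sT : ∀ i j, (T i j).isSome ↔ i = j ∧ blockLevel i = l + 1 := by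
    intro i j
    rw [hT, isSome_sub, sR]
    exact ⟨fun h => h.elim id (sQ i j), Or.inl⟩
  have sG : ∀ i j, (G i j).isSome → i = j ∧ blockLevel i = l + 1 := by
    intro i j h
    rw [hG, isSome_orth, sT] at h
    exact ⟨h.1, h.2.2⟩
  have sB : ∀ i j, (B i j).isSome → BlockDesc i j ∧ blockLevel i ≤ l ∧ blockLevel j = l + 1 := by
    intro i j h
    obtain ⟨m, h1, h2⟩ := exists_of_isSome_mul h
    rw [← (sG m j h2).1]
    exact sA i m h1
  refine ⟨?_, ?_⟩
  · have hval : (dyadicStep N S₀ (l + 1) P).val = fun i j : Fin (2 ^ N - 1) =>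
        if (j : ℕ) + 1 ∈ pyrLevel N (l + 1) then
          if (i : ℕ) + 1 ∈ pyrLevel N (l + 1) then G i j else B.neg.val i j
        else P i j := by
      simp only [dyadicStep, Prog.val_bind, Prog.val_pure]
      rfl
    rw [hval]
    have hSm : S₀.toMatrix = S := toMatrix_ofMatrix hS
    have hSt : S.transpose = S := hpos.isHermitian
    set L := proj (n := 2 ^ N - 1) k fun i => blockLevel i = l + 1 with hL
    have hLt : L.transpose = L := transpose_proj _
    have mE : E.toMatrix = (proj k fun i => blockLevel i ≤ l) * S * L := by
      rw [hE, toMatrix_restrict, hSm, proj_congr (succ_mem_pyrLevel hl),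
        proj_congr succ_mem_pyrBelow, proj_congr fun i => Nat.lt_succ_iff]
    have mF : F.toMatrix = P.toMatrix.transpose * S * L := by
      rw [hF, toMatrix_mul, toMatrix_transpose, mE, ← Matrix.mul_assoc, ← Matrix.mul_assoc]
      congr 2
      rw [← transpose_proj, ← Matrix.transpose_mul]
      exact congrArg Matrix.transpose
        (proj_mul_toMatrix fun i j h => (hP.desc i j h).1.trans (hP.level i j h))
    have mDF : (proj k fun i => blockLevel i ≤ l) * F.toMatrix = F.toMatrix :=
      proj_mul_toMatrix fun i j h => (sF i j h).2.1
    have mT : T.toMatrix = L * S * L - F.toMatrix.transpose * F.toMatrix := by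
      rw [hT, toMatrix_sub, hQ, toMatrix_mul, toMatrix_transpose, hR, toMatrix_restrict, hSm,
        proj_congr (succ_mem_pyrLevel hl)]
    have mG : G.toMatrix.transpose * T.toMatrix * G.toMatrix = L := by
      refine orth_gram T _ (fun i j h => ((sT i j).1 h).1) (fun i => by simp [sT]) ?_
      intro i hi
      rw [mT, ← schur_complement hSt hLt hP.gram mDF mF, ← toMatrix_mul]
      refine posDef_block hpos ?_
      have hAi : A i i = none := by
        by_contra h
        have := sA i i (Option.isSome_iff_ne_none.2 h)
        omega
      have : block i i (L - A.toMatrix) = block i i L - block i i A.toMatrix := rfl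
      rw [← hA, this, block_toMatrix, hAi, hL, block_proj_self hi]
      exact sub_zero _
    have mLG : L * G.toMatrix = G.toMatrix := proj_mul_toMatrix fun i j h => (sG i j h).2
    refine ⟨fun i j h => ?_, fun i j h => ?_, ?_⟩
    · split_ifs at h with h1 h2
      · rw [(sG i j h).1]
        exact DyadicDesc.refl _
      · rw [isSome_neg] at h
        exact (sB i j h).1
      · exact hP.desc i j h
    · split_ifs at h with h1 h2
      · exact ((succ_mem_pyrLevel hl j).1 h1).le
      · exact ((succ_mem_pyrLevel hl j).1 h1).le
      · exact (hP.level i j h).trans (Nat.le_succ l)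
    · have hnew : toMatrix (fun i j : Fin (2 ^ N - 1) =>
          if (j : ℕ) + 1 ∈ pyrLevel N (l + 1) then
            if (i : ℕ) + 1 ∈ pyrLevel N (l + 1) then G i j else B.neg.val i j
          else P i j) =
          P.toMatrix - P.toMatrix * F.toMatrix * G.toMatrix + G.toMatrix := by
        rw [← toMatrix_mul, ← hA, ← toMatrix_mul, ← hB]
        -- of the blocks of `P`, `B` and `G` in the same position at most one is stored
        ext ⟨i, p⟩ ⟨j, q⟩
        have hz : ∀ {X : SparseMat ℝ (2 ^ N - 1) k}, ¬ (X i j).isSome →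
            X.toMatrix (i, p) (j, q) = 0 := fun h => by
          by_contra h0
          exact h (isSome_of_toMatrix_ne h0)
        rw [Matrix.add_apply, Matrix.sub_apply]
        rw [toMatrix_apply]
        simp only [succ_mem_pyrLevel hl]
        split_ifs with h1 h2
        · rw [← toMatrix_apply, hz (X := P), hz (X := B)]
          · ring
          · intro h
            have := (sB i j h).2.1
            omega
          · intro h
            have := hP.level i j h
            omega
        · rw [← toMatrix_apply, hz (X := P), hz (X := G), toMatrix_neg, Matrix.neg_apply]
          · ring
          · exact fun h => h2 (sG i j h).2
          · intro h
            have := hP.level i j h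
            omega
        · rw [← toMatrix_apply, hz (X := B), hz (X := G)]
          · ring
          · exact fun h => h1 ((sG i j h).1 ▸ (sG i j h).2)
          · exact fun h => h1 (sB i j h).2.2
      rw [hnew, gram_append hSt hLt hP.gram mDF mF mLG (mT ▸ mG)]
      rw [hL, proj, proj, proj, Matrix.diagonal_add]
      congr 1
      funext x
      split_ifs <;> first | omega | norm_num
  · have hflops : (dyadicStep N S₀ (l + 1) P).flops =
        (P.transpose.mul E).flops + ((P.mul F).flops + ((F.transpose.mul F).flops +
          ((R.sub Q).flops + (T.orth.flops + ((A.mul G).flops + (B.neg.flops + 0)))))) := by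
      simp only [dyadicStep, Prog.flops_bind, Prog.flops_pure]
      rfl
    rw [hflops]
    have rowF : ∀ i, (Finset.univ.filter fun j => (F i j).isSome = true).card ≤ 1 := fun i =>
      card_row_le_one F i fun j h => ⟨(sF i j h).1, (sF i j h).2.2⟩
    have rowP : ∀ i, (Finset.univ.filter fun j => (P i j).isSome = true).card ≤ N := fun i =>
      card_row_le P i (hP.desc i)
    have rowDiag : ∀ X : SparseMat ℝ (2 ^ N - 1) k,
        (∀ i j, (X i j).isSome → i = j ∧ blockLevel i = l + 1) →
        ∀ i, (Finset.univ.filter fun j => (X i j).isSome = true).card ≤ 1 := by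
      refine fun X hX i => card_row_le_one (l := l + 1) X i fun j h => ?_
      obtain ⟨rfl, h'⟩ := hX i j h
      exact ⟨DyadicDesc.refl _, h'⟩
    have c1 := flops_mul_le_of_cols P.transpose E N 1 (by simpa using rowP)
      fun i => card_row_le_one E i (sE i)
    have c2 := flops_mul_le_of_rows P F N 1 rowP rowF
    have c3 := flops_mul_le_of_cols F.transpose F 1 1 (by simpa using rowF) rowF
    have c4 := flops_sub_le R Q 1 (rowDiag Q sQ)
    have c5 := flops_orth_le T
    have c6 := flops_mul_le_of_rows A G 1 1
      (fun i => card_row_le_one A i fun j h => ⟨(sA i j h).1, (sA i j h).2.2⟩) (rowDiag G sG)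
    have c7 := flops_neg_le B 1
      (fun i => card_row_le_one B i fun j h => ⟨(sB i j h).1, (sB i j h).2.2⟩)
    have hk : k ^ 2 ≤ k ^ 3 := by
      rcases Nat.eq_zero_or_pos k with rfl | hk
      · simp
      · exact Nat.pow_le_pow_right hk (by norm_num)
    have h1 : (2 ^ N - 1) * 1 * k ^ 2 ≤ (2 ^ N - 1) * k ^ 3 := by
      rw [mul_one]
      exact Nat.mul_le_mul_left _ hk
    have h2 : (2 ^ N - 1) * k ^ 3 ≤ N * ((2 ^ N - 1) * k ^ 3) := Nat.le_mul_of_pos_left _ hN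
    have e1 : (2 ^ N - 1) * (N * 1) * (3 * k ^ 3) = 3 * (N * ((2 ^ N - 1) * k ^ 3)) := by ring
    have e2 : (2 ^ N - 1) * (1 * 1) * (3 * k ^ 3) = 3 * ((2 ^ N - 1) * k ^ 3) := by ring
    have e3 : (2 ^ N - 1) * (11 * k ^ 3) = 11 * ((2 ^ N - 1) * k ^ 3) := by ring
    have e4 : 25 * N * (2 ^ N - 1) * k ^ 3 = 25 * (N * ((2 ^ N - 1) * k ^ 3)) := by ring
    rw [e4]
    rw [e1] at c1 c2
    rw [e2] at c3 c6
    rw [e3] at c5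
    omega

lemma dyadicLoop_spec (hN : 1 ≤ N) (hS : HasBlockPattern (SDPattern N) S) (hpos : S.PosDef)
    (m : ℕ) :
    IsPartialOrthogonalization S (m + 1) (dyadicLoop N (ofMatrix (SDPattern N) S) m).val ∧
    (dyadicLoop N (ofMatrix (SDPattern N) S) m).flops ≤
      (m + 1) * (25 * N * (2 ^ N - 1) * k ^ 3) := by
  induction m with
  | zero =>
    refine ⟨isPartialOrthogonalization_orth hS hpos, (flops_orth_le _).trans ?_⟩
    have : (2 ^ N - 1) * k ^ 3 ≤ N * ((2 ^ N - 1) * k ^ 3) := Nat.le_mul_of_pos_left _ hN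
    calc (2 ^ N - 1) * (11 * k ^ 3) = 11 * ((2 ^ N - 1) * k ^ 3) := by ring
      _ ≤ 25 * (N * ((2 ^ N - 1) * k ^ 3)) := by omega
      _ = _ := by ring
  | succ m ih =>
    obtain ⟨h1, h2⟩ := dyadicStep_spec hN hS hpos ih.1
    refine ⟨by simpa only [dyadicLoop, Prog.val_bind] using h1, ?_⟩
    simp only [dyadicLoop, Prog.flops_bind]
    calc _ ≤ _ := Nat.add_le_add ih.2 h2
      _ = _ := by ring

end Algorithm

lemma half_mul_log_two_le {N : ℕ} (hN : 2 ≤ N) :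
    (N : ℝ) / 2 * Real.log 2 ≤ Real.log (2 ^ N - 1) := by
  obtain ⟨m, rfl⟩ : ∃ m, N = m + 2 := ⟨N - 2, by omega⟩
  have h1 : (1 : ℝ) ≤ 2 ^ (m + 1) := one_le_pow₀ (by norm_num)
  have h2 : Real.log (2 ^ (m + 1)) ≤ Real.log (2 ^ (m + 2) - 1) := by
    refine Real.log_le_log (by positivity) ?_
    rw [pow_succ _ (m + 1)]
    linarith
  rw [Real.log_pow] at h2
  refine le_trans (mul_le_mul_of_nonneg_right ?_ (Real.log_nonneg (by norm_num))) h2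
  push_cast
  linarith [(Nat.cast_nonneg m : (0 : ℝ) ≤ m)]

theorem theorem3p7 :
    ∃ C : ℝ, 0 < C ∧ ∀ N k : ℕ, 1 ≤ N → 1 ≤ k →
      ∀ S : Matrix (Fin (2 ^ N - 1) × Fin k) (Fin (2 ^ N - 1) × Fin k) ℝ,
        HasBlockPattern (SDPattern N) S → S.PosDef →
        ∀ (P : Matrix (Fin (2 ^ N - 1) × Fin k) (Fin (2 ^ N - 1) × Fin k) ℝ) (d : ℝ),
          P = (dyadicAlgorithm N (SparseMat.ofMatrix (SDPattern N) S)).val.toMatrix →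
          d = (k : ℝ) * (2 ^ N - 1) →
          HasBlockPattern (VDPattern N) P ∧
          P.transpose * S * P = 1 ∧
          (2 ≤ N →
            ((dyadicAlgorithm N (SparseMat.ofMatrix (SDPattern N) S)).flops : ℝ) ≤
              C * (d * (k : ℝ) ^ 2 * Real.log (d / k) ^ 2)) := by
  have hlog2 : 0 < Real.log 2 := Real.log_pos (by norm_num)
  refine ⟨100 / Real.log 2 ^ 2, by positivity, ?_⟩
  intro N k hN hk S hS hpos P d hP hd
  obtain ⟨hinv, hflops⟩ := dyadicLoop_spec hN hS hpos (N - 1)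
  rw [Nat.sub_add_cancel hN] at hinv hflops
  refine ⟨?_, ?_, fun hN2 => ?_⟩
  · intro i j hij p q
    by_contra h0
    rw [hP] at h0
    exact hij ((succ_mem_VDPattern i j).2 (hinv.desc i j (isSome_of_toMatrix_ne h0)))
  · rw [hP]
    refine hinv.gram.trans ?_
    simp [proj, blockLevel_le]
  · have hk0 : (0 : ℝ) < k := by exact_mod_cast hk
    have hn0 : (0 : ℝ) ≤ 2 ^ N - 1 := by
      have : (1 : ℝ) ≤ 2 ^ N := one_le_pow₀ (by norm_num)
      linarith
    have hdk : d / k = 2 ^ N - 1 := by rw [hd, mul_div_cancel_left₀ _ hk0.ne']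
    have hcast : ((2 ^ N - 1 : ℕ) : ℝ) = 2 ^ N - 1 := by
      rw [Nat.cast_sub Nat.one_le_two_pow]
      norm_num
    have hfl : ((dyadicAlgorithm N (SparseMat.ofMatrix (SDPattern N) S)).flops : ℝ) ≤
        N * (25 * N * (2 ^ N - 1) * k ^ 3) := by
      rw [← hcast]
      exact_mod_cast hflops
    have hsq : ((N : ℝ) / 2 * Real.log 2) ^ 2 ≤ Real.log (2 ^ N - 1) ^ 2 :=
      pow_le_pow_left₀ (by positivity) (half_mul_log_two_le hN2) 2
    rw [hdk, hd]
    calc _ ≤ _ := hfl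
      _ = 100 / Real.log 2 ^ 2 * (k * (2 ^ N - 1) * (k : ℝ) ^ 2 *
            ((N : ℝ) / 2 * Real.log 2) ^ 2) := by
          field_simp
          ring
      _ ≤ _ := by gcongr
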